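/- Let $0<q<1$, $0<aq,bq,cq<1$ and $d<0$. Write $(z;q)_k=\prod_{j=0}^{k-1}(1-zq^j)$, $(z_1,\dots,z_r;q)_k=\prod_l (z_l;q)_k$, $[k]_q=\frac{q^k-1}{q-1}$ and $\binom{n}{k}_q=\frac{(q;q)_n}{(q;q)_k(q;q)_{n-k}}$. Define $$D_q^1f(x,y)=\frac{f(qx,y)-f(x,y)}{(q-1)x},\qquad D_{q^{-1}}^1f(x,y)=\frac{q\,(f(x,y)-f(x/q,y))}{(q-1)x},$$ and define $D_q^2$, $D_{q^{-1}}^2$ in the same way with respect to $y$. The bivariate big $q$-Jacobi equation with parameter $\lambda$ is $$a_{11}\sqrt q\,D_q^1D_{q^{-1}}^1u+a_{22}\sqrt q\,D_q^2D_{q^{-1}}^2u+a_{12a}\,D_q^1D_q^2u+a_{12d}\,D_{q^{-1}}^1D_{q^{-1}}^2u+b_1\,D_q^1u+b_2\,D_q^2u+\lambda u=0\qquad(x,y\neq0),$$ where $$a_{11}=\sqrt q\,(dq-x)(acq^2-x),\quad a_{22}=\sqrt q\,(aq-y)(dq-y),\quad a_{12a}=acq^4(d-bx)(1-y),\quad a_{12d}=(dq-x)(aq-y),$$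 $$b_1=\frac{q\,\bigl(q\,(d-acdq^2+acq\,(1+bq(x-1)))-x\bigr)}{q-1},\qquad b_2=\frac{q\,\bigl(dq+aq\,(1-dq+bcq^2(y-1))-y\bigr)}{q-1}.$$ Put $\lambda_N=q^{2-N}[N]_q\,\frac{1-abcq^{N+2}}{q-1}$. Then for all integers $n,m\ge0$ there is exactly one real polynomial $\widehat P_{n,m}(x,y)=\widehat P_{n,m}(x,y;a,b,c,d;q)$ of the form $x^ny^m+(\text{terms of total degree lower than }n+m)$ that satisfies this equation with $\lambda=\lambda_{n+m}$, and for all real $x,y$ one has $$\widehat P_{n,m}(x,y)=K_{n,m}\sum_{i=0}^{n}\sum_{j=0}^{m}\frac{(-1)^{-i-j}\binom ni_q\binom mj_q\,q^{\frac12\left(i(i-2n+1)+j(j-2m+1)\right)}\,(abcq^{m+n+2};q)_{i+j}}{(aq;q)_j\,(bq;q)_i\,(dq^{n+1};q)_j\,(abcq^{m+2}/d;q)_i}\,(bx/d;q)_i\,(y;q)_j$$ $$=K_{n,m}\;\Phi^{1:2;2}_{0:2;2}\left(\begin{matrix}abcq^{n+m+2}:\ q^{-n},\,bx/d;\ q^{-m},\,y\\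 -:\ bq,\,abcq^{m+2}/d;\ aq,\,dq^{n+1}\end{matrix}\ \Big|\ q:q,q;\ 0,0,0\right),$$ with the prefactor $$K_{n,m}=\frac{(d/b)^n\,(aq;q)_m\,(bq;q)_n\,(dq^{n+1};q)_m\,(abcq^{m+2}/d;q)_n}{(abcq^{m+n+2};q)_{n+m}}.$$ Here the generalized bivariate basic hypergeometric ($q$-Kampé de Fériet) series is $$\Phi^{\lambda:r;s}_{\mu:u;v}\left(\begin{matrix}\alpha_1,\dots,\alpha_\lambda:\ a_1,\dots,a_r;\ c_1,\dots,c_s\\ \beta_1,\dots,\beta_\mu:\ b_1,\dots,b_u;\ d_1,\dots,d_v\end{matrix}\ \Big|\ q:x,y;\ i,j,k\right)$$ $$=\sum_{M,N=0}^{\infty}\frac{(\alpha_1,\dots,\alpha_\lambda;q)_{M+N}\,(a_1,\dots,a_r;q)_M\,(c_1,\dots,c_s;q)_N}{(\beta_1,\dots,\beta_\mu;q)_{M+N}\,(b_1,\dots,b_u;q)_M\,(d_1,\dots,d_v;q)_N}\;\frac{x^My^N\,q^{i\binom M2+j\binom N2+kMN}}{(q;q)_M\,(q;q)_N},$$ and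 in the case above it terminates: the terms with $M>n$ or $N>m$ vanish. -/

import Mathlib

/-- The `q`-shifted factorial `(z; q)_k = ∏_{j < k} (1 - z q ^ j)`. -/
noncomputable def qPoch (z q : ℝ) (k : ℕ) : ℝ :=
  ∏ j ∈ Finset.range k, (1 - z * q ^ j)

/-- The product `(z₁, …, z_r; q)_k = (z₁; q)_k ⋯ (z_r; q)_k`. -/
noncomputable def qPochList (zs : List ℝ) (q : ℝ) (k : ℕ) : ℝ :=
  (zs.map fun z => qPoch z q k).prod

/-- The `q`-number `[k]_q = (q ^ k - 1) / (q - 1)`. -/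
noncomputable def qNum (q : ℝ) (k : ℕ) : ℝ :=
  (q ^ k - 1) / (q - 1)

/-- The `q`-binomial coefficient `(q; q)_n / ((q; q)_k (q; q)_{n-k})`, for `k ≤ n`. -/
noncomputable def qBinom (q : ℝ) (n k : ℕ) : ℝ :=
  qPoch q q n / (qPoch q q k * qPoch q q (n - k))

/-- The general term of the generalized bivariate basic hypergeometric series with numerator
parameters `αs` (index `r + s`), `as` (index `r`), `cs` (index `s`), denominator parameters
`βs` (index `r + s`), `bs` (index `r`), `ds` (index `s`), arguments `x, y` and quadratic
exponents `i, j, k`. -/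
noncomputable def qKampeTerm (αs as cs βs bs ds : List ℝ) (q x y : ℝ) (i j k : ℤ)
    (p : ℕ × ℕ) : ℝ :=
  qPochList αs q (p.1 + p.2) * qPochList as q p.1 * qPochList cs q p.2 /
      (qPochList βs q (p.1 + p.2) * qPochList bs q p.1 * qPochList ds q p.2) *
    (x ^ p.1 * y ^ p.2 *
        q ^ (i * (p.1.choose 2 : ℤ) + j * (p.2.choose 2 : ℤ) + k * (p.1 : ℤ) * (p.2 : ℤ)) /
      (qPoch q q p.1 * qPoch q q p.2))

/-- The generalized bivariate basic hypergeometric (`q`-Kampé de Fériet) series. -/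
noncomputable def qKampe (αs as cs βs bs ds : List ℝ) (q x y : ℝ) (i j k : ℤ) : ℝ :=
  ∑' p : ℕ × ℕ, qKampeTerm αs as cs βs bs ds q x y i j k p

/-- The partial `q`-difference operator `D_q^1`. -/
noncomputable def qDx (q : ℝ) (f : ℝ → ℝ → ℝ) (x y : ℝ) : ℝ :=
  (f (q * x) y - f x y) / ((q - 1) * x)

/-- The partial `q`-difference operator `D_q^2`. -/
noncomputable def qDy (q : ℝ) (f : ℝ → ℝ → ℝ) (x y : ℝ) : ℝ :=
  (f x (q * y) - f x y) / ((q - 1) * y)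

/-- The partial `q`-difference operator `D_{q⁻¹}^1`. -/
noncomputable def qDxInv (q : ℝ) (f : ℝ → ℝ → ℝ) (x y : ℝ) : ℝ :=
  q * (f x y - f (x / q) y) / ((q - 1) * x)

/-- The partial `q`-difference operator `D_{q⁻¹}^2`. -/
noncomputable def qDyInv (q : ℝ) (f : ℝ → ℝ → ℝ) (x y : ℝ) : ℝ :=
  q * (f x y - f x (y / q)) / ((q - 1) * y)

/-- The second-order partial `q`-difference operator
`a₁₁ √q D_q^1 D_{q⁻¹}^1 + a₂₂ √q D_q^2 D_{q⁻¹}^2 + a₁₂ₐ D_q^1 D_q^2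
  + a₁₂d D_{q⁻¹}^1 D_{q⁻¹}^2 + b₁ D_q^1 + b₂ D_q^2`. -/
noncomputable def qDiffOp (q : ℝ) (a11 a22 : ℝ → ℝ) (a12a a12d : ℝ → ℝ → ℝ) (b1 b2 : ℝ → ℝ)
    (u : ℝ → ℝ → ℝ) (x y : ℝ) : ℝ :=
  a11 x * Real.sqrt q * qDx q (qDxInv q u) x y
    + a22 y * Real.sqrt q * qDy q (qDyInv q u) x y
    + a12a x y * qDx q (qDy q u) x y
    + a12d x y * qDxInv q (qDyInv q u) x y
    + b1 x * qDx q u x y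
    + b2 y * qDy q u x y

/-- The operator of the bivariate big `q`-Jacobi equation. -/
noncomputable def bigQJacobiOp (q a b c d : ℝ) : (ℝ → ℝ → ℝ) → ℝ → ℝ → ℝ :=
  qDiffOp q
    (fun x => Real.sqrt q * (d * q - x) * (a * c * q ^ 2 - x))
    (fun y => Real.sqrt q * (a * q - y) * (d * q - y))
    (fun x y => a * c * q ^ 4 * (d - b * x) * (1 - y))
    (fun x y => (d * q - x) * (a * q - y))
    (fun x => q * (q * (d - a * c * d * q ^ 2 + a * c * q * (1 + b * q * (-1 + x))) - x) /
      (-1 + q))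
    (fun y => q * (d * q + a * q * (1 - d * q + b * c * q ^ 2 * (-1 + y)) - y) / (-1 + q))

/-- `λ_N = q ^ (2 - N) [N]_q (1 - a b c q ^ (N + 2)) / (q - 1)`. -/
noncomputable def bigQJacobiEigenvalue (q a b c : ℝ) (N : ℕ) : ℝ :=
  q ^ (2 - (N : ℤ)) * qNum q N * ((1 - a * b * c * q ^ (N + 2)) / (q - 1))

/-- The value at `(x, y)` of a real polynomial in two variables. -/
noncomputable def evalXY (P : MvPolynomial (Fin 2) ℝ) (x y : ℝ) : ℝ :=
  MvPolynomial.eval ![x, y] P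

/-- `P = x ^ n y ^ m + terms of total degree lower than n + m`. -/
def IsMonicBivariate (n m : ℕ) (P : MvPolynomial (Fin 2) ℝ) : Prop :=
  ∀ s : Fin 2 →₀ ℕ, n + m ≤ s 0 + s 1 →
    MvPolynomial.coeff s (P - MvPolynomial.X 0 ^ n * MvPolynomial.X 1 ^ m) = 0

/-- `P` is a monic polynomial solution, with leading term `x ^ n y ^ m`, of the bivariate big
`q`-Jacobi equation with `λ = λ_{n+m}`. The difference quotients are only meaningful for
`x ≠ 0` and `y ≠ 0`. -/
def IsMonicBigQJacobiSolution (q a b c d : ℝ) (n m : ℕ) (P : MvPolynomial (Fin 2) ℝ) : Prop :=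
  IsMonicBivariate n m P ∧
    ∀ x y : ℝ, x ≠ 0 → y ≠ 0 →
      bigQJacobiOp q a b c d (evalXY P) x y
        + bigQJacobiEigenvalue q a b c (n + m) * evalXY P x y = 0

/-- The prefactor
`(d/b)^n (aq;q)_m (bq;q)_n (d q^{n+1};q)_m (abc q^{m+2}/d;q)_n / (abc q^{m+n+2};q)_{n+m}`. -/
noncomputable def monicPrefactor (q a b c d : ℝ) (n m : ℕ) : ℝ :=
  (d / b) ^ n * qPoch (a * q) q m * qPoch (b * q) q n * qPoch (d * q ^ (n + 1)) q m *
      qPoch (a * b * c * q ^ (m + 2) / d) q n /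
    qPoch (a * b * c * q ^ (m + n + 2)) q (n + m)

/-- The explicit double sum over `0 ≤ i ≤ n`, `0 ≤ j ≤ m`. Both `i (i - 2n + 1)` and
`j (j - 2m + 1)` are even, so the division of the exponent by two is exact. -/
noncomputable def monicDoubleSum (q a b c d : ℝ) (n m : ℕ) (x y : ℝ) : ℝ :=
  ∑ i ∈ Finset.range (n + 1), ∑ j ∈ Finset.range (m + 1),
    (-1 : ℝ) ^ (-(i : ℤ) - (j : ℤ)) * qBinom q n i * qBinom q m j *
        q ^ (((i : ℤ) * ((i : ℤ) - 2 * (n : ℤ) + 1) +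
          (j : ℤ) * ((j : ℤ) - 2 * (m : ℤ) + 1)) / 2) *
        qPoch (a * b * c * q ^ (m + n + 2)) q (i + j) /
      (qPoch (a * q) q j * qPoch (b * q) q i * qPoch (d * q ^ (n + 1)) q j *
        qPoch (a * b * c * q ^ (m + 2) / d) q i) *
      qPoch (b * x / d) q i * qPoch y q j

/-- The general term of the series `Φ^{1:2;2}_{0:2;2}` in the closed form of the monic solution. -/
noncomputable def monicKampeTerm (q a b c d : ℝ) (n m : ℕ) (x y : ℝ) : ℕ × ℕ → ℝ :=
  qKampeTerm [a * b * c * q ^ (n + m + 2)] [q ^ (-(n : ℤ)), b * x / d] [q ^ (-(m : ℤ)), y]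
    [] [b * q, a * b * c * q ^ (m + 2) / d] [a * q, d * q ^ (n + 1)] q q q 0 0 0

/-- The series `Φ^{1:2;2}_{0:2;2}` in the closed form of the monic solution. -/
noncomputable def monicKampe (q a b c d : ℝ) (n m : ℕ) (x y : ℝ) : ℝ :=
  qKampe [a * b * c * q ^ (n + m + 2)] [q ^ (-(n : ℤ)), b * x / d] [q ^ (-(m : ℤ)), y]
    [] [b * q, a * b * c * q ^ (m + 2) / d] [a * q, d * q ^ (n + 1)] q q q 0 0 0

/-! In the basis `(bx/d; q)_i (y; q)_j` the operator is triangular: it multiplies the `(i, j)`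
element by `-λ_{i+j}` and adds multiples of the elements `(i-1, j)`, `(i, j-1)`, `(i-1, j-1)`
(`bigQJacobiOp_qPoch_mul_qPoch`).

Uniqueness: modulo lower degree the operator is therefore the scalar `-λ_k` on degree `k`
(`exists_image_of_mem_degLT_succ`). Two monic solutions differ by an eigenpolynomial of degree below
`N = n + m` for `λ_N`, and `λ_k ≠ λ_N` for `k < N` forces it to vanish, one degree at a time
(`eq_zero_of_mem_degLT_of_image`).

Existence: on coefficients in this basis, the equation becomes a four-term recurrence. The
hypergeometric coefficients satisfy it by a rational identity in `q^i, q^j, q^n, q^m`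
(`jacobiCoeff_recurrence`). The factors `(q^{-n}; q)_i` and `(q^{-m}; q)_j` cut the sum off, and the
prefactor is the reciprocal of its leading coefficient (`monicPrefactor_mul_lead`). The two
displayed forms are this same finite sum. -/

/-! ### The operator on products of `q`-shifted factorials -/

lemma qPoch_zero (z q : ℝ) : qPoch z q 0 = 1 := by simp [qPoch]

lemma qPoch_succ (z q : ℝ) (k : ℕ) : qPoch z q (k + 1) = qPoch z q k * (1 - z * q ^ k) := by
  simp [qPoch, Finset.prod_range_succ]

lemma qPoch_succ' (z q : ℝ) (k : ℕ) : qPoch z q (k + 1) = (1 - z) * qPoch (q * z) q k := by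
  rw [qPoch, Finset.prod_range_succ', qPoch, mul_comm]
  congr 1
  · simp
  · exact Finset.prod_congr rfl fun j _ => by ring

/-- A forward difference acts diagonally once multiplied by `1 - z`. The factors `d - b x` and `1 -
y` beside the forward differences in `bigQJacobiOp_mul` play this role. -/
lemma one_sub_mul_qPoch_shift (z q : ℝ) (k : ℕ) :
    (1 - z) * (qPoch (q * z) q k - qPoch z q k) = z * (1 - q ^ k) * qPoch z q k := by
  have h := qPoch_succ' z q k
  rw [qPoch_succ] at h
  linear_combination -h

/-- A backward difference lowers the index. At `k = 0` the truncated `k - 1` is harmless because `1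
- q ^ 0 = 0`. -/
lemma qPoch_sub_shift_inv {q : ℝ} (hq : q ≠ 0) (z : ℝ) (k : ℕ) :
    q * (qPoch z q k - qPoch (z / q) q k) = z * (1 - q ^ k) * qPoch z q (k - 1) := by
  cases k with
  | zero => simp [qPoch_zero]
  | succ k =>
    rw [qPoch_succ' (z / q), mul_div_cancel₀ z hq, qPoch_succ, Nat.add_sub_cancel]
    field_simp
    ring

/-- At `k = 0` the truncated index breaks the recursion; the alternative `q ^ k = 1` is what makes
the factors `1 - q ^ k` vanish there. -/
lemma qPoch_pred {q : ℝ} (z : ℝ) (k : ℕ) :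
    q ^ k = 1 ∨ q * qPoch z q k = (q - z * q ^ k) * qPoch z q (k - 1) := by
  cases k with
  | zero => simp
  | succ k =>
    right
    rw [qPoch_succ, Nat.add_sub_cancel]
    ring

/-- The value of the operator on a product `f x * g y`, in terms of the values of `f` at
`q x, x, x / q` and of `g` at `q y, y, y / q`. -/
lemma bigQJacobiOp_mul {q : ℝ} (hq0 : 0 < q) (hq1 : q < 1) (a b c d : ℝ) (f g : ℝ → ℝ)
    {x y : ℝ} (hx : x ≠ 0) (hy : y ≠ 0) :
    bigQJacobiOp q a b c d (fun x y => f x * g y) x y =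
      q / (q - 1) ^ 2 *
        ((a * c * q ^ 3 * (1 - x) / x * ((d - b * x) * (f (q * x) - f x) / x)
            - (d * q - x) * (a * c * q ^ 2 - x) / x * (q * (f x - f (x / q)) / x)) * g y
          + ((a * d * q ^ 2 - a * b * c * q ^ 3 * y) / y * ((1 - y) * (g (q * y) - g y) / y)
            - (a * q - y) * (d * q - y) / y * (q * (g y - g (y / q)) / y)) * f x)
        + 1 / (q - 1) ^ 2 *
          (a * c * q ^ 4 * ((d - b * x) * (f (q * x) - f x) / x)
              * ((1 - y) * (g (q * y) - g y) / y)
            + (d * q - x) * (a * q - y) * (q * (f x - f (x / q)) / x)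
              * (q * (g y - g (y / q)) / y)) := by
  have hq : q ≠ 0 := hq0.ne'
  have hq' : q - 1 ≠ 0 := by linarith
  have hq'' : -1 + q ≠ 0 := by linarith
  have e1 : q * x / q = x := by field_simp
  have e2 : q * y / q = y := by field_simp
  -- One `√q` comes from `a₁₁` or `a₂₂`, the other from the equation.
  have hs : ∀ u v w : ℝ, √q * u * v * √q * w = q * u * v * w := fun u v w => by
    linear_combination (u * v * w) * Real.mul_self_sqrt hq0.le
  have e3 : -1 + q = q - 1 := by ring
  simp only [bigQJacobiOp, qDiffOp, qDx, qDy, qDxInv, qDyInv, e1, e2, hs, e3]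
  generalize f (q * x) = f₁
  generalize f (x / q) = f₂
  generalize g (q * y) = g₁
  generalize g (y / q) = g₂
  generalize f x = f₀
  generalize g y = g₀
  field_simp
  ring

lemma bigQJacobiEigenvalue_eq {q : ℝ} (hq0 : 0 < q) (hq1 : q < 1) (a b c : ℝ) (N : ℕ) :
    bigQJacobiEigenvalue q a b c N =
      -(q ^ 2 / (q - 1) ^ 2 * ((1 - q ^ N) * (1 - a * b * c * q ^ (N + 2)) / q ^ N)) := by
  have hq : q ≠ 0 := hq0.ne'
  have hq' : q - 1 ≠ 0 := by linarith
  rw [bigQJacobiEigenvalue, qNum, zpow_sub₀ hq, zpow_natCast, zpow_ofNat]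
  field_simp
  ring

/-- The action of the operator on the products `(b x / d; q)_i (y; q)_j`. -/
lemma bigQJacobiOp_qPoch_mul_qPoch {q : ℝ} (hq0 : 0 < q) (hq1 : q < 1) (a : ℝ) {b : ℝ}
    (hb : b ≠ 0) (c : ℝ) {d : ℝ} (hd : d ≠ 0) (i j : ℕ) {x y : ℝ} (hx : x ≠ 0) (hy : y ≠ 0) :
    bigQJacobiOp q a b c d (fun x y => qPoch (b / d * x) q i * qPoch (1 * y) q j) x y =
      -bigQJacobiEigenvalue q a b c (i + j) * (qPoch (b / d * x) q i * qPoch (1 * y) q j)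
      + q ^ 2 / (q - 1) ^ 2 * ((1 - q ^ i) * (1 - b * q ^ i) * (a * b * c * q / d - 1 / q ^ (i + j)))
        * (qPoch (b / d * x) q (i - 1) * qPoch (1 * y) q j)
      + q ^ 2 / (q - 1) ^ 2 * ((1 - q ^ j) * (1 - a * q ^ j) * (d - 1 / q ^ (i + j)))
        * (qPoch (b / d * x) q i * qPoch (1 * y) q (j - 1))
      + q ^ 2 / (q - 1) ^ 2 *
          ((1 - q ^ i) * (1 - q ^ j) * (1 - b * q ^ i) * (1 - a * q ^ j) / q ^ (i + j))
        * (qPoch (b / d * x) q (i - 1) * qPoch (1 * y) q (j - 1)) := by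
  rw [bigQJacobiOp_mul hq0 hq1 a b c d (fun x => qPoch (b / d * x) q i)
    (fun y => qPoch (1 * y) q j) hx hy, bigQJacobiEigenvalue_eq hq0 hq1]
  have hq : q ≠ 0 := hq0.ne'
  have hq' : q - 1 ≠ 0 := by linarith
  have h1 := one_sub_mul_qPoch_shift (b / d * x) q i
  have h2 := qPoch_sub_shift_inv hq (b / d * x) i
  have h3 := qPoch_pred (q := q) (b / d * x) i
  have k1 := one_sub_mul_qPoch_shift y q j
  have k2 := qPoch_sub_shift_inv hq y j
  have k3 := qPoch_pred (q := q) y j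
  have e1 : b / d * (q * x) = q * (b / d * x) := by ring
  have e2 : b / d * (x / q) = b / d * x / q := by ring
  have hp : q ^ i ≠ 0 := pow_ne_zero _ hq
  have hr : q ^ j ≠ 0 := pow_ne_zero _ hq
  simp only [e1, e2, h2, k2, k1, one_mul, pow_add]
  have h1' : (d - b * x) * (qPoch (q * (b / d * x)) q i - qPoch (b / d * x) q i) =
      b * x * (1 - q ^ i) * qPoch (b / d * x) q i := by
    have : d - b * x = d * (1 - b / d * x) := by field_simp
    rw [this, mul_assoc, h1]
    field_simp
  rw [h1']
  clear h1 h1' h2 k1 k2 e1 e2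
  generalize qPoch (b / d * x) q i = F at *
  generalize qPoch (b / d * x) q (i - 1) = F' at *
  generalize qPoch y q j = G at *
  generalize qPoch y q (j - 1) = G' at *
  generalize q ^ i = p at *
  generalize q ^ j = r at *
  have h3' : p = 1 ∨ F = (d * q - b * x * p) / (d * q) * F' := by
    refine h3.imp_right fun h => ?_
    field_simp at h ⊢
    linear_combination h
  have k3' : r = 1 ∨ G = (q - y * r) / q * G' := by
    refine k3.imp_right fun h => ?_
    field_simp
    linear_combination h
  -- Either index may be zero; in each case a rational identity remains.
  rcases h3' with rfl | rfl <;> rcases k3' with rfl | rfl <;> field_simp <;> ring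

/-! ### Degree filtration and leading terms -/

section Polynomials

open MvPolynomial

/-- The real polynomials in two variables of total degree lower than `k`. -/
def degLT (k : ℕ) : Submodule ℝ (MvPolynomial (Fin 2) ℝ) where
  carrier := {p | ∀ s : Fin 2 →₀ ℕ, k ≤ s 0 + s 1 → coeff s p = 0}
  add_mem' hp hp' s hs := by rw [coeff_add, hp s hs, hp' s hs, add_zero]
  zero_mem' s _ := coeff_zero s
  smul_mem' c p hp s hs := by rw [coeff_smul, hp s hs, smul_zero]

lemma degLT_mono {k l : ℕ} (h : k ≤ l) : degLT k ≤ degLT l :=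
  fun _ hp s hs => hp s (h.trans hs)

lemma degLT_zero {p : MvPolynomial (Fin 2) ℝ} (hp : p ∈ degLT 0) : p = 0 := by
  ext s
  exact hp s (Nat.zero_le _)

lemma X_mul_mem_degLT {k : ℕ} {p : MvPolynomial (Fin 2) ℝ} (hp : p ∈ degLT k) (v : Fin 2) :
    X v * p ∈ degLT (k + 1) := by
  intro s hs
  rw [coeff_X_mul']
  split_ifs with h
  · refine hp _ ?_
    have : 1 ≤ s v := Nat.one_le_iff_ne_zero.mpr (Finsupp.mem_support_iff.mp h)
    fin_cases v <;> simp at this ⊢ <;> omega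
  · rfl

lemma monomial_eq_smul_X_pow (s : Fin 2 →₀ ℕ) (c : ℝ) :
    monomial s c = c • (X 0 ^ s 0 * X 1 ^ s 1 : MvPolynomial (Fin 2) ℝ) := by
  rw [monomial_eq, Finsupp.prod_fintype _ _ (fun _ => pow_zero _), Fin.prod_univ_two,
    smul_eq_C_mul]

lemma X_pow_mul_X_pow_mem_degLT {i j k : ℕ} (h : i + j < k) :
    (X 0 ^ i * X 1 ^ j : MvPolynomial (Fin 2) ℝ) ∈ degLT k := by
  have key : ∀ i j : ℕ, (X 0 ^ i * X 1 ^ j : MvPolynomial (Fin 2) ℝ) ∈ degLT (i + j + 1) := by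
    intro i
    induction i with
    | zero =>
      intro j
      induction j with
      | zero =>
        intro s hs
        rw [pow_zero, pow_zero, one_mul, coeff_one, if_neg]
        rintro rfl
        simp at hs
      | succ j ih =>
        have e : (X 0 ^ 0 * X 1 ^ (j + 1) : MvPolynomial (Fin 2) ℝ) =
            X 1 * (X 0 ^ 0 * X 1 ^ j) := by rw [pow_succ]; ring
        rw [e]
        exact X_mul_mem_degLT ih 1
    | succ i ih =>
      intro j
      have := X_mul_mem_degLT (ih j) 0
      have e : i + 1 + j + 1 = i + j + 1 + 1 := by ring
      rw [e]
      convert this using 1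
      ring
  exact degLT_mono h (key i j)

lemma evalXY_add (p r : MvPolynomial (Fin 2) ℝ) (x y : ℝ) :
    evalXY (p + r) x y = evalXY p x y + evalXY r x y := by simp [evalXY]

lemma evalXY_smul (t : ℝ) (p : MvPolynomial (Fin 2) ℝ) (x y : ℝ) :
    evalXY (t • p) x y = t * evalXY p x y := by simp [evalXY]

lemma evalXY_sum {ι : Type*} (s : Finset ι) (p : ι → MvPolynomial (Fin 2) ℝ) (x y : ℝ) :
    evalXY (∑ i ∈ s, p i) x y = ∑ i ∈ s, evalXY (p i) x y := by simp [evalXY]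

/-- Multiplying by `X 0 * X 1` makes the polynomial vanish on the axes too, where nothing is
assumed. -/
lemma eq_zero_of_evalXY_eq_zero {p : MvPolynomial (Fin 2) ℝ}
    (hp : ∀ x y : ℝ, x ≠ 0 → y ≠ 0 → evalXY p x y = 0) : p = 0 := by
  have h : (X 0 * X 1 * p : MvPolynomial (Fin 2) ℝ) = 0 := by
    refine MvPolynomial.funext fun v => ?_
    have hv : v = ![v 0, v 1] := by ext i; fin_cases i <;> rfl
    by_cases h0 : v 0 = 0
    · simp [h0]
    by_cases h1 : v 1 = 0
    · simp [h1]
    have := hp _ _ h0 h1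
    rw [evalXY, ← hv] at this
    simp [this]
  simpa [MvPolynomial.X_ne_zero] using h

/-- The product `(t X_v; q)_k` as a polynomial. -/
noncomputable def qPochPoly (q t : ℝ) (v : Fin 2) (k : ℕ) : MvPolynomial (Fin 2) ℝ :=
  ∏ j ∈ Finset.range k, (1 - (t * q ^ j) • X v)

/-- The polynomial `(t x; q)_i (y; q)_j`. -/
noncomputable def qPochBasis (q t : ℝ) (i j : ℕ) : MvPolynomial (Fin 2) ℝ :=
  qPochPoly q t 0 i * qPochPoly q 1 1 j

lemma evalXY_qPochBasis (q t : ℝ) (i j : ℕ) (x y : ℝ) :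
    evalXY (qPochBasis q t i j) x y = qPoch (t * x) q i * qPoch (1 * y) q j := by
  simp only [evalXY, qPochBasis, qPochPoly, qPoch, map_mul, map_prod, map_sub, map_one, smul_eval,
    eval_X, Matrix.cons_val_zero, Matrix.cons_val_one]
  congr 1 <;> exact Finset.prod_congr rfl fun _ _ => by ring

/-- The leading coefficient of `(t X; q)_k`. -/
noncomputable def qPochLead (q t : ℝ) (k : ℕ) : ℝ :=
  ∏ j ∈ Finset.range k, -(t * q ^ j)

lemma qPochLead_succ (q t : ℝ) (k : ℕ) :
    qPochLead q t (k + 1) = qPochLead q t k * -(t * q ^ k) := Finset.prod_range_succ _ _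

lemma qPochLead_ne_zero {q t : ℝ} (hq : q ≠ 0) (ht : t ≠ 0) (k : ℕ) : qPochLead q t k ≠ 0 :=
  Finset.prod_ne_zero_iff.mpr fun _ _ => neg_ne_zero.mpr (mul_ne_zero ht (pow_ne_zero _ hq))

/-- The induction step for leading terms: a factor `1 - t X_v` multiplies the top part by `-t X_v`
and otherwise contributes lower degree. -/
lemma one_sub_smul_X_mul_sub_mem {k : ℕ} {p M : MvPolynomial (Fin 2) ℝ} {l : ℝ}
    (hM : M ∈ degLT (k + 1)) (hp : p - l • M ∈ degLT k) (t : ℝ) (v : Fin 2) :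
    (1 - t • X v) * p - (l * -t) • (X v * M) ∈ degLT (k + 1) := by
  have e : (1 - t • X v) * p - (l * -t) • (X v * M) =
      (p - l • M) + l • M - t • (X v * (p - l • M)) := by
    simp only [smul_eq_C_mul, map_mul, map_neg]
    ring
  rw [e]
  exact sub_mem (add_mem (degLT_mono (Nat.le_succ k) hp) (Submodule.smul_mem _ _ hM))
    (Submodule.smul_mem _ _ (X_mul_mem_degLT hp v))

lemma qPochBasis_sub_mem (q t : ℝ) (i j : ℕ) :
    qPochBasis q t i j - (qPochLead q t i * qPochLead q 1 j) • (X 0 ^ i * X 1 ^ j) ∈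
      degLT (i + j) := by
  induction i with
  | zero =>
    induction j with
    | zero => simp [qPochBasis, qPochPoly, qPochLead]
    | succ j ih =>
      have := one_sub_smul_X_mul_sub_mem (X_pow_mul_X_pow_mem_degLT (Nat.lt_succ_self (0 + j))) ih
        (1 * q ^ j) 1
      have e1 : qPochBasis q t 0 (j + 1) = (1 - (1 * q ^ j) • X 1) * qPochBasis q t 0 j := by
        simp only [qPochBasis, qPochPoly, Finset.prod_range_succ]
        ring
      have e2 : (qPochLead q t 0 * qPochLead q 1 (j + 1)) •
          (X 0 ^ 0 * X 1 ^ (j + 1) : MvPolynomial (Fin 2) ℝ) =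
          (qPochLead q t 0 * qPochLead q 1 j * -(1 * q ^ j)) • (X 1 * (X 0 ^ 0 * X 1 ^ j)) := by
        rw [qPochLead_succ, pow_succ (X 1), ← mul_assoc (qPochLead q t 0)]
        congr 1
        ring
      rw [e1, e2]
      exact this
  | succ i ih =>
    have := one_sub_smul_X_mul_sub_mem (X_pow_mul_X_pow_mem_degLT (Nat.lt_succ_self (i + j))) ih
      (t * q ^ i) 0
    have e : i + 1 + j = i + j + 1 := by ring
    rw [e]
    convert this using 2
    · simp only [qPochBasis, qPochPoly, Finset.prod_range_succ]
      ring
    · rw [qPochLead_succ]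
      congr 1 <;> ring

lemma qPochBasis_mem (q t : ℝ) {i j k : ℕ} (h : i + j < k) : qPochBasis q t i j ∈ degLT k := by
  have := add_mem (degLT_mono h.le (qPochBasis_sub_mem q t i j))
    (Submodule.smul_mem _ (qPochLead q t i * qPochLead q 1 j) (X_pow_mul_X_pow_mem_degLT h))
  simpa using this

/-! ### The operator as a relation between polynomials -/

/-- The polynomial `r` represents the image of `p` under the big `q`-Jacobi operator. -/
def IsBigQJacobiImage (q a b c d : ℝ) (p r : MvPolynomial (Fin 2) ℝ) : Prop :=
  ∀ x y : ℝ, x ≠ 0 → y ≠ 0 → bigQJacobiOp q a b c d (evalXY p) x y = evalXY r x y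

namespace IsBigQJacobiImage

variable {q a b c d : ℝ} {p p' r r' : MvPolynomial (Fin 2) ℝ}

lemma add (h : IsBigQJacobiImage q a b c d p r) (h' : IsBigQJacobiImage q a b c d p' r') :
    IsBigQJacobiImage q a b c d (p + p') (r + r') := by
  intro x y hx hy
  rw [evalXY_add, ← h x y hx hy, ← h' x y hx hy]
  simp only [bigQJacobiOp, qDiffOp, qDx, qDy, qDxInv, qDyInv, evalXY_add]
  ring

lemma smul (t : ℝ) (h : IsBigQJacobiImage q a b c d p r) :
    IsBigQJacobiImage q a b c d (t • p) (t • r) := by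
  intro x y hx hy
  rw [evalXY_smul, ← h x y hx hy]
  simp only [bigQJacobiOp, qDiffOp, qDx, qDy, qDxInv, qDyInv, evalXY_smul]
  ring

lemma zero : IsBigQJacobiImage q a b c d 0 0 := by
  intro x y _ _
  simp [bigQJacobiOp, qDiffOp, qDx, qDy, qDxInv, qDyInv, evalXY]

lemma sub (h : IsBigQJacobiImage q a b c d p r) (h' : IsBigQJacobiImage q a b c d p' r') :
    IsBigQJacobiImage q a b c d (p - p') (r - r') := by
  simpa [sub_eq_add_neg] using h.add (h'.smul (-1))

lemma sum {ι : Type*} (s : Finset ι) {p r : ι → MvPolynomial (Fin 2) ℝ}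
    (h : ∀ i ∈ s, IsBigQJacobiImage q a b c d (p i) (r i)) :
    IsBigQJacobiImage q a b c d (∑ i ∈ s, p i) (∑ i ∈ s, r i) := by
  classical
  induction s using Finset.induction_on with
  | empty => simpa using zero
  | insert i s hi ih =>
    rw [Finset.sum_insert hi, Finset.sum_insert hi]
    exact (h i (Finset.mem_insert_self i s)).add
      (ih fun k hk => h k (Finset.mem_insert_of_mem hk))

lemma eq (h : IsBigQJacobiImage q a b c d p r) (h' : IsBigQJacobiImage q a b c d p r') :
    r = r' := by
  refine sub_eq_zero.mp (eq_zero_of_evalXY_eq_zero fun x y hx hy => ?_)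
  rw [sub_eq_add_neg, ← neg_one_smul ℝ r', evalXY_add, evalXY_smul, ← h x y hx hy,
    ← h' x y hx hy]
  ring

end IsBigQJacobiImage

lemma isMonicBigQJacobiSolution_iff {q a b c d : ℝ} {n m : ℕ} {P : MvPolynomial (Fin 2) ℝ} :
    IsMonicBigQJacobiSolution q a b c d n m P ↔
      P - X 0 ^ n * X 1 ^ m ∈ degLT (n + m) ∧
        IsBigQJacobiImage q a b c d P (-bigQJacobiEigenvalue q a b c (n + m) • P) := by
  refine and_congr Iff.rfl (forall₄_congr fun x y _ _ => ?_)
  rw [evalXY_smul, neg_mul, eq_neg_iff_add_eq_zero]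

/-- The part of lower degree of the image of `(b x / d; q)_i (y; q)_j` under the operator. -/
noncomputable def basisImageLower (q a b c d : ℝ) (i j : ℕ) : MvPolynomial (Fin 2) ℝ :=
  (q ^ 2 / (q - 1) ^ 2 * ((1 - q ^ i) * (1 - b * q ^ i) * (a * b * c * q / d - 1 / q ^ (i + j))))
      • qPochBasis q (b / d) (i - 1) j
    + (q ^ 2 / (q - 1) ^ 2 * ((1 - q ^ j) * (1 - a * q ^ j) * (d - 1 / q ^ (i + j))))
      • qPochBasis q (b / d) i (j - 1)
    + (q ^ 2 / (q - 1) ^ 2 *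
        ((1 - q ^ i) * (1 - q ^ j) * (1 - b * q ^ i) * (1 - a * q ^ j) / q ^ (i + j)))
      • qPochBasis q (b / d) (i - 1) (j - 1)

lemma isBigQJacobiImage_qPochBasis {q : ℝ} (hq0 : 0 < q) (hq1 : q < 1) (a : ℝ) {b : ℝ}
    (hb : b ≠ 0) (c : ℝ) {d : ℝ} (hd : d ≠ 0) (i j : ℕ) :
    IsBigQJacobiImage q a b c d (qPochBasis q (b / d) i j)
      (-bigQJacobiEigenvalue q a b c (i + j) • qPochBasis q (b / d) i j
        + basisImageLower q a b c d i j) := by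
  intro x y hx hy
  have e : evalXY (qPochBasis q (b / d) i j) =
      fun x y => qPoch (b / d * x) q i * qPoch (1 * y) q j := by
    funext x y
    exact evalXY_qPochBasis _ _ _ _ _ _
  rw [e, bigQJacobiOp_qPoch_mul_qPoch hq0 hq1 a hb c hd i j hx hy]
  simp only [basisImageLower, evalXY_add, evalXY_smul, evalXY_qPochBasis]
  ring

lemma basisImageLower_mem (q a b c d : ℝ) (i j : ℕ) :
    basisImageLower q a b c d i j ∈ degLT (i + j) := by
  refine add_mem (add_mem ?_ ?_) ?_
  -- For index zero the truncated subtraction does not lower the degree, but the coefficient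
  -- contains `1 - q ^ 0 = 0`.
  · rcases Nat.eq_zero_or_pos i with rfl | hi
    · simp
    · exact Submodule.smul_mem _ _ (qPochBasis_mem _ _ (by omega))
  · rcases Nat.eq_zero_or_pos j with rfl | hj
    · simp
    · exact Submodule.smul_mem _ _ (qPochBasis_mem _ _ (by omega))
  · rcases Nat.eq_zero_or_pos i with rfl | hi
    · simp
    · exact Submodule.smul_mem _ _ (qPochBasis_mem _ _ (by omega))

/-! ### Triangularity and uniqueness -/

section Triangular

variable {q a b c d : ℝ}

/-- Up to the nonzero leading coefficient `l`, the monomial is a basis element minus a remainder of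
lower degree, which `ih` handles. -/
lemma exists_image_X_pow_mul_X_pow (hq0 : 0 < q) (hq1 : q < 1) (hb : b ≠ 0) (hd : d ≠ 0)
    {i j : ℕ}
    (ih : ∀ p ∈ degLT (i + j), ∃ r ∈ degLT (i + j), IsBigQJacobiImage q a b c d p r) :
    ∃ r ∈ degLT (i + j), IsBigQJacobiImage q a b c d (X 0 ^ i * X 1 ^ j)
      (-bigQJacobiEigenvalue q a b c (i + j) • (X 0 ^ i * X 1 ^ j) + r) := by
  obtain ⟨r, hr, hrel⟩ := ih _ (qPochBasis_sub_mem q (b / d) i j)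
  have hl : qPochLead q (b / d) i * qPochLead q 1 j ≠ 0 :=
    mul_ne_zero (qPochLead_ne_zero hq0.ne' (div_ne_zero hb hd) i)
      (qPochLead_ne_zero hq0.ne' one_ne_zero j)
  have hw := qPochBasis_sub_mem q (b / d) i j
  have hB := isBigQJacobiImage_qPochBasis hq0 hq1 a hb c hd i j
  set l := qPochLead q (b / d) i * qPochLead q 1 j
  set B := qPochBasis q (b / d) i j
  set M : MvPolynomial (Fin 2) ℝ := X 0 ^ i * X 1 ^ j
  refine ⟨l⁻¹ • (-bigQJacobiEigenvalue q a b c (i + j) • (B - l • M)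
      + basisImageLower q a b c d i j - r),
    Submodule.smul_mem _ _ (sub_mem (add_mem (Submodule.smul_mem _ _ hw)
      (basisImageLower_mem q a b c d i j)) hr), ?_⟩
  convert (hB.sub hrel).smul l⁻¹ using 1
  · rw [sub_sub_cancel, inv_smul_smul₀ hl]
  · have : M = l⁻¹ • l • M := (inv_smul_smul₀ hl M).symm
    nth_rewrite 1 [this]
    module

lemma exists_image_of_mem_degLT_succ (hq0 : 0 < q) (hq1 : q < 1) (hb : b ≠ 0) (hd : d ≠ 0)
    {k : ℕ} (ih : ∀ p ∈ degLT k, ∃ r ∈ degLT k, IsBigQJacobiImage q a b c d p r)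
    {p : MvPolynomial (Fin 2) ℝ} (hp : p ∈ degLT (k + 1)) :
    ∃ r ∈ degLT k, IsBigQJacobiImage q a b c d p (-bigQJacobiEigenvalue q a b c k • p + r) := by
  have key : ∀ s ∈ p.support, ∃ r ∈ degLT k, IsBigQJacobiImage q a b c d (monomial s (coeff s p))
      (-bigQJacobiEigenvalue q a b c k • monomial s (coeff s p) + r) := by
    intro s hs
    have hsk : s 0 + s 1 < k + 1 := by
      by_contra! h
      exact mem_support_iff.mp hs (hp s h)
    rw [monomial_eq_smul_X_pow]
    rcases Nat.lt_succ_iff_lt_or_eq.mp hsk with h | rfl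
    · have hm := Submodule.smul_mem _ (coeff s p) (X_pow_mul_X_pow_mem_degLT h)
      obtain ⟨r, hr, hrel⟩ := ih _ hm
      -- Below degree `k` the term `λ_k • monomial` is itself of lower degree and is absorbed into
      -- the remainder.
      refine ⟨r + bigQJacobiEigenvalue q a b c k • coeff s p • (X 0 ^ s 0 * X 1 ^ s 1),
        add_mem hr (Submodule.smul_mem _ _ hm), ?_⟩
      convert hrel using 1
      module
    · obtain ⟨r, hr, hrel⟩ := exists_image_X_pow_mul_X_pow hq0 hq1 hb hd ih
      refine ⟨coeff s p • r, Submodule.smul_mem _ _ hr, ?_⟩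
      convert hrel.smul (coeff s p) using 1
      module
  choose! r hr hrel using key
  refine ⟨∑ s ∈ p.support, r s, Submodule.sum_mem _ hr, ?_⟩
  have := IsBigQJacobiImage.sum p.support hrel
  rwa [Finset.sum_add_distrib, ← Finset.smul_sum, support_sum_monomial_coeff] at this

lemma exists_image_of_mem_degLT (hq0 : 0 < q) (hq1 : q < 1) (hb : b ≠ 0) (hd : d ≠ 0) (k : ℕ) :
    ∀ p ∈ degLT k, ∃ r ∈ degLT k, IsBigQJacobiImage q a b c d p r := by
  induction k with
  | zero =>
    intro p hp
    rw [degLT_zero hp]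
    exact ⟨0, zero_mem _, .zero⟩
  | succ k ih =>
    intro p hp
    obtain ⟨r, hr, hrel⟩ := exists_image_of_mem_degLT_succ hq0 hq1 hb hd ih hp
    exact ⟨_, add_mem (Submodule.smul_mem _ _ hp) (degLT_mono (Nat.le_succ k) hr), hrel⟩

lemma bigQJacobiEigenvalue_sub (hq0 : 0 < q) (hq1 : q < 1) (a b c : ℝ) (k N : ℕ) :
    bigQJacobiEigenvalue q a b c N - bigQJacobiEigenvalue q a b c k =
      -(q ^ 2 / (q - 1) ^ 2 *
        ((q ^ k - q ^ N) * (1 - a * b * c * q ^ (N + 2) * q ^ k) / (q ^ N * q ^ k))) := by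
  have hq : q ≠ 0 := hq0.ne'
  have hq' : q - 1 ≠ 0 := by linarith
  rw [bigQJacobiEigenvalue_eq hq0 hq1, bigQJacobiEigenvalue_eq hq0 hq1]
  field_simp
  ring

lemma mul_pow_lt_one (hq0 : 0 < q) (hq1 : q < 1) (ha0 : 0 < a * q) (ha1 : a * q < 1)
    (hb0 : 0 < b * q) (hb1 : b * q < 1) (hc0 : 0 < c * q) (hc1 : c * q < 1) {k : ℕ} (hk : 3 ≤ k) :
    a * b * c * q ^ k < 1 := by
  obtain ⟨l, rfl⟩ := Nat.exists_eq_add_of_le hk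
  have h1 : a * q * (b * q) < 1 := mul_lt_one_of_nonneg_of_lt_one_left ha0.le ha1 hb1.le
  have h2 : a * q * (b * q) * (c * q) < 1 :=
    mul_lt_one_of_nonneg_of_lt_one_left (mul_pos ha0 hb0).le h1 hc1.le
  have h3 : a * q * (b * q) * (c * q) * q ^ l < 1 :=
    mul_lt_one_of_nonneg_of_lt_one_left (by positivity) h2 (pow_le_one₀ hq0.le hq1.le)
  calc a * b * c * q ^ (3 + l) = a * q * (b * q) * (c * q) * q ^ l := by ring
    _ < 1 := h3

/-- The difference factors through `q^k - q^N` and `1 - abc q^{N+2+k}`. Since `N ≥ 1`, the latter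
exponent is at least 3, so `abc q^3 = (aq)(bq)(cq) < 1` applies. -/
lemma bigQJacobiEigenvalue_ne (hq0 : 0 < q) (hq1 : q < 1) (ha0 : 0 < a * q) (ha1 : a * q < 1)
    (hb0 : 0 < b * q) (hb1 : b * q < 1) (hc0 : 0 < c * q) (hc1 : c * q < 1) {k N : ℕ}
    (h : k < N) : bigQJacobiEigenvalue q a b c N - bigQJacobiEigenvalue q a b c k ≠ 0 := by
  rw [bigQJacobiEigenvalue_sub hq0 hq1, neg_ne_zero]
  have h1 : q ^ N < q ^ k := pow_lt_pow_right_of_lt_one₀ hq0 hq1 h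
  have h2 : a * b * c * q ^ (N + 2) * q ^ k < 1 := by
    rw [mul_assoc, ← pow_add]
    exact mul_pow_lt_one hq0 hq1 ha0 ha1 hb0 hb1 hc0 hc1 (by omega)
  have h3 : q - 1 ≠ 0 := by linarith
  have h4 : q ^ k - q ^ N ≠ 0 := (sub_pos.mpr h1).ne'
  have h5 : 1 - a * b * c * q ^ (N + 2) * q ^ k ≠ 0 := (sub_pos.mpr h2).ne'
  have hq : q ≠ 0 := hq0.ne'
  positivity

/-- An eigenpolynomial of total degree lower than `N` for the eigenvalue `λ_N` vanishes. -/
lemma eq_zero_of_mem_degLT_of_image (hq0 : 0 < q) (hq1 : q < 1) (ha0 : 0 < a * q)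
    (ha1 : a * q < 1) (hb0 : 0 < b * q) (hb1 : b * q < 1) (hc0 : 0 < c * q) (hc1 : c * q < 1)
    (hd : d ≠ 0) {N : ℕ} {p : MvPolynomial (Fin 2) ℝ}
    (h : IsBigQJacobiImage q a b c d p (-bigQJacobiEigenvalue q a b c N • p))
    {k : ℕ} (hkN : k ≤ N) (hp : p ∈ degLT k) : p = 0 := by
  have hb : b ≠ 0 := left_ne_zero_of_mul hb0.ne'
  induction k with
  | zero => exact degLT_zero hp
  | succ k ih =>
    refine ih (by omega) ?_
    obtain ⟨r, hr, hrel⟩ := exists_image_of_mem_degLT_succ hq0 hq1 hb hd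
      (exists_image_of_mem_degLT hq0 hq1 hb hd k) hp
    have hne := bigQJacobiEigenvalue_ne hq0 hq1 ha0 ha1 hb0 hb1 hc0 hc1 (k := k) (N := N)
      (by omega)
    have e := h.eq hrel
    -- Comparing the two expressions for the image of `p` shows that `p` is a multiple of the
    -- lower-degree `r`, so its degree bound drops.
    have e' : (bigQJacobiEigenvalue q a b c N - bigQJacobiEigenvalue q a b c k) • p = -r := by
      rw [sub_smul]
      rw [neg_smul, neg_smul] at e
      rw [neg_eq_iff_eq_neg.mp e]
      module
    rw [← inv_smul_smul₀ hne p, e']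
    exact Submodule.smul_mem _ _ (neg_mem hr)

end Triangular

/-! ### Hypergeometric coefficients -/

lemma qPoch_pos {z q : ℝ} (hq0 : 0 < q) (hq1 : q < 1) (hz : z < 1) (k : ℕ) : 0 < qPoch z q k := by
  refine Finset.prod_pos fun j _ => ?_
  have h0 : 0 < q ^ j := pow_pos hq0 j
  have h1 : q ^ j ≤ 1 := pow_le_one₀ hq0.le hq1.le
  rcases le_total z 0 with h | h
  · nlinarith
  · nlinarith

lemma qPoch_inv_pow_eq_zero {q : ℝ} (hq : q ≠ 0) {n i : ℕ} (h : n < i) :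
    qPoch (q ^ (-(n : ℤ))) q i = 0 := by
  refine Finset.prod_eq_zero (Finset.mem_range.mpr h) ?_
  rw [zpow_neg, zpow_natCast, inv_mul_cancel₀ (pow_ne_zero _ hq), sub_self]

/-- The factor `(q ^ (-n), q)_i q ^ i / (β, ε, q; q)_i` of the general term of the series. -/
noncomputable def hyperCoeff (q : ℝ) (n : ℕ) (β ε : ℝ) (i : ℕ) : ℝ :=
  qPoch (q ^ (-(n : ℤ))) q i * q ^ i / (qPoch β q i * qPoch ε q i * qPoch q q i)

lemma hyperCoeff_eq_zero {q : ℝ} (hq : q ≠ 0) {n i : ℕ} (h : n < i) (β ε : ℝ) :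
    hyperCoeff q n β ε i = 0 := by
  rw [hyperCoeff, qPoch_inv_pow_eq_zero hq h, zero_mul, zero_div]

lemma one_sub_mul_pow_pos {z q : ℝ} (hq0 : 0 < q) (hq1 : q < 1) (hz : z < 1) (k : ℕ) :
    0 < 1 - z * q ^ k := by
  have h := qPoch_pos hq0 hq1 hz (k + 1)
  rw [qPoch_succ] at h
  exact (pos_iff_pos_of_mul_pos h).mp (qPoch_pos hq0 hq1 hz k)

/-- The factors on the left are those in `basisImageLower`, with `β = bq` or `β = aq`; the bounds on
`β` and `ε` keep the denominators nonzero. -/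
lemma hyperCoeff_succ {q : ℝ} (hq0 : 0 < q) (hq1 : q < 1) {β ε : ℝ} (hβ : β < 1) (hε : ε < 1)
    (n i : ℕ) :
    (1 - q ^ (i + 1)) * (1 - β * q ^ i) * hyperCoeff q n β ε (i + 1) =
      hyperCoeff q n β ε i * ((1 - q ^ i / q ^ n) * q / (1 - ε * q ^ i)) := by
  have h1 := (qPoch_pos hq0 hq1 hβ i).ne'
  have h2 := (qPoch_pos hq0 hq1 hε i).ne'
  have h3 := (qPoch_pos hq0 hq1 hq1 i).ne'
  have h4 := (one_sub_mul_pow_pos hq0 hq1 hβ i).ne'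
  have h5 := (one_sub_mul_pow_pos hq0 hq1 hε i).ne'
  have h6 := (one_sub_mul_pow_pos hq0 hq1 hq1 i).ne'
  have hn : q ^ n ≠ 0 := pow_ne_zero _ hq0.ne'
  have e : q ^ (i + 1) = q * q ^ i := pow_succ' q i
  simp only [hyperCoeff, qPoch_succ, zpow_neg, zpow_natCast, e]
  generalize q ^ i = p at *
  generalize 1 - β * p = B at *
  generalize 1 - ε * p = E at *
  generalize 1 - q * p = Q at *
  field_simp

/-- The coefficient of `(b x / d; q)_i (y; q)_j` in the series. -/
noncomputable def jacobiCoeff (q a b c d : ℝ) (n m i j : ℕ) : ℝ :=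
  qPoch (a * b * c * q ^ (m + n + 2)) q (i + j) *
    (hyperCoeff q n (b * q) (a * b * c * q ^ (m + 2) / d) i *
      hyperCoeff q m (a * q) (d * q ^ (n + 1)) j)

/-- Used to reindex the lowering terms: the end at `0` vanishes through `1 - q ^ 0`, the end at `n +
1` through `(q^{-n}; q)_{n+1} = 0`. -/
lemma Finset.sum_range_succ_shift {M : Type*} [AddCommMonoid M] (g : ℕ → M) (n : ℕ)
    (h0 : g 0 = 0) (hn : g (n + 1) = 0) :
    ∑ i ∈ Finset.range (n + 1), g i = ∑ i ∈ Finset.range (n + 1), g (i + 1) := by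
  have h1 := Finset.sum_range_succ g (n + 1)
  rw [Finset.sum_range_succ', h0, hn, add_zero, add_zero] at h1
  exact h1.symm

/-! ### The recurrence and the monic solution -/

section Solution

variable {q a b c d : ℝ}

lemma mul_mul_pow_div_neg (hq0 : 0 < q) (ha0 : 0 < a * q) (hb0 : 0 < b * q) (hc0 : 0 < c * q)
    (hd : d < 0) (m : ℕ) : a * b * c * q ^ (m + 2) / d < 0 := by
  have ha := pos_of_mul_pos_left ha0 hq0.le
  have hb := pos_of_mul_pos_left hb0 hq0.le
  have hc := pos_of_mul_pos_left hc0 hq0.le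
  exact div_neg_of_pos_of_neg (by positivity) hd

/-- The left side is the coefficient of the `(i, j)` basis element after applying the operator plus
`λ_{n+m}` to the series. Each shifted coefficient is a rational multiple of the unshifted one. -/
lemma jacobiCoeff_recurrence (hq0 : 0 < q) (hq1 : q < 1) (ha0 : 0 < a * q) (ha1 : a * q < 1)
    (hb0 : 0 < b * q) (hb1 : b * q < 1) (hc0 : 0 < c * q) (hd : d < 0) (n m i j : ℕ) :
    (bigQJacobiEigenvalue q a b c (n + m) - bigQJacobiEigenvalue q a b c (i + j))
        * jacobiCoeff q a b c d n m i j
      + q ^ 2 / (q - 1) ^ 2 * ((1 - q ^ (i + 1)) * (1 - b * q ^ (i + 1))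
          * (a * b * c * q / d - 1 / q ^ (i + 1 + j))) * jacobiCoeff q a b c d n m (i + 1) j
      + q ^ 2 / (q - 1) ^ 2 * ((1 - q ^ (j + 1)) * (1 - a * q ^ (j + 1))
          * (d - 1 / q ^ (i + (j + 1)))) * jacobiCoeff q a b c d n m i (j + 1)
      + q ^ 2 / (q - 1) ^ 2 * ((1 - q ^ (i + 1)) * (1 - q ^ (j + 1)) * (1 - b * q ^ (i + 1))
          * (1 - a * q ^ (j + 1)) / q ^ (i + 1 + (j + 1)))
        * jacobiCoeff q a b c d n m (i + 1) (j + 1) = 0 := by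
  have hε : a * b * c * q ^ (m + 2) / d < 1 :=
    (mul_mul_pow_div_neg hq0 ha0 hb0 hc0 hd m).trans one_pos
  have hφ : d * q ^ (n + 1) < 1 := (mul_neg_of_neg_of_pos hd (by positivity)).trans one_pos
  have hV := hyperCoeff_succ hq0 hq1 hb1 hε n i
  have hW := hyperCoeff_succ hq0 hq1 ha1 hφ m j
  have h1 := (one_sub_mul_pow_pos hq0 hq1 hε i).ne'
  have h2 := (one_sub_mul_pow_pos hq0 hq1 hφ j).ne'
  rw [bigQJacobiEigenvalue_sub hq0 hq1]
  have e1 : i + 1 + j = i + j + 1 := by ring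
  have e2 : i + (j + 1) = i + j + 1 := by ring
  have e3 : i + 1 + (j + 1) = i + j + 2 := by ring
  have hU2 : ∀ z : ℝ, qPoch z q (i + j + 2) =
      qPoch z q (i + j) * (1 - z * q ^ (i + j)) * (1 - z * q ^ (i + j + 1)) := fun z => by
    rw [← qPoch_succ, ← qPoch_succ]
  simp only [jacobiCoeff, e1, e2, e3, hU2, qPoch_succ _ _ (i + j)]
  have f1 : b * q ^ (i + 1) = b * q * q ^ i := by ring
  have f2 : a * q ^ (j + 1) = a * q * q ^ j := by ring
  rw [f1, f2]
  have hq : q ≠ 0 := hq0.ne'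
  have hq' : q - 1 ≠ 0 := by linarith
  have hd' : d ≠ 0 := hd.ne
  generalize hyperCoeff q n (b * q) (a * b * c * q ^ (m + 2) / d) (i + 1) = V' at *
  generalize hyperCoeff q n (b * q) (a * b * c * q ^ (m + 2) / d) i = V at *
  generalize hyperCoeff q m (a * q) (d * q ^ (n + 1)) (j + 1) = W' at *
  generalize hyperCoeff q m (a * q) (d * q ^ (n + 1)) j = W at *
  generalize qPoch (a * b * c * q ^ (m + n + 2)) q (i + j) = U at *
  set s := q ^ (i + j) with hs
  set t := 1 - a * b * c * q ^ (m + n + 2) * s with ht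
  set t' := 1 - a * b * c * q ^ (m + n + 2) * q ^ (i + j + 1) with ht'
  have g1 : (1 - q ^ (i + 1)) * (1 - b * q * q ^ i) * (a * b * c * q / d - 1 / q ^ (i + j + 1))
        * (U * t * (V' * W)) = U * t * W * (a * b * c * q / d - 1 / q ^ (i + j + 1))
        * (V * ((1 - q ^ i / q ^ n) * q / (1 - a * b * c * q ^ (m + 2) / d * q ^ i))) := by
    rw [← hV]; ring
  have g2 : (1 - q ^ (j + 1)) * (1 - a * q * q ^ j) * (d - 1 / q ^ (i + j + 1))
        * (U * t * (V * W')) = U * t * V * (d - 1 / q ^ (i + j + 1))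
        * (W * ((1 - q ^ j / q ^ m) * q / (1 - d * q ^ (n + 1) * q ^ j))) := by
    rw [← hW]; ring
  have g3 : (1 - q ^ (i + 1)) * (1 - q ^ (j + 1)) * (1 - b * q * q ^ i) * (1 - a * q * q ^ j)
        / q ^ (i + j + 2) * (U * t * t' * (V' * W')) = U * t * t' / q ^ (i + j + 2)
        * (V * ((1 - q ^ i / q ^ n) * q / (1 - a * b * c * q ^ (m + 2) / d * q ^ i)))
        * (W * ((1 - q ^ j / q ^ m) * q / (1 - d * q ^ (n + 1) * q ^ j))) := by
    rw [← hW, ← hV]; ring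
  rw [mul_assoc (q ^ 2 / (q - 1) ^ 2) _ (U * t * (V' * W)), g1,
    mul_assoc (q ^ 2 / (q - 1) ^ 2) _ (U * t * (V * W')), g2,
    mul_assoc (q ^ 2 / (q - 1) ^ 2) _ (U * t * t' * (V' * W')), g3]
  -- The eigenvalue difference contains the same factor `t` that a Pochhammer shift produces, so `U
  -- t V W` can be taken out of all four terms.
  have ht2 : 1 - a * b * c * q ^ (n + m + 2) * s = t := by rw [ht, add_comm n m]
  rw [ht2]
  have key : -((s - q ^ (n + m)) / (q ^ (n + m) * s))
      + (a * b * c * q / d - 1 / q ^ (i + j + 1))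
        * ((1 - q ^ i / q ^ n) * q / (1 - a * b * c * q ^ (m + 2) / d * q ^ i))
      + (d - 1 / q ^ (i + j + 1)) * ((1 - q ^ j / q ^ m) * q / (1 - d * q ^ (n + 1) * q ^ j))
      + t' / q ^ (i + j + 2)
        * ((1 - q ^ i / q ^ n) * q / (1 - a * b * c * q ^ (m + 2) / d * q ^ i))
        * ((1 - q ^ j / q ^ m) * q / (1 - d * q ^ (n + 1) * q ^ j)) = 0 := by
    clear_value t
    clear hV hW g1 g2 g3 ht ht2 hU2
    simp only [ht', hs, pow_add, pow_one] at h1 h2 ⊢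
    have hi : q ^ i ≠ 0 := pow_ne_zero _ hq
    have hj : q ^ j ≠ 0 := pow_ne_zero _ hq
    have hn : q ^ n ≠ 0 := pow_ne_zero _ hq
    have hm : q ^ m ≠ 0 := pow_ne_zero _ hq
    generalize q ^ i = p at *
    generalize q ^ j = r at *
    generalize q ^ n = x at *
    generalize q ^ m = y at *
    have h1' : d - a * b * c * (y * q ^ 2) * p ≠ 0 := by
      intro h
      apply h1
      field_simp
      linear_combination h
    have e : 1 - a * b * c * (y * q ^ 2) / d * p = (d - a * b * c * (y * q ^ 2) * p) / d := by
      field_simp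
    rw [e]
    -- The two denominators are kept as atoms while fractions are cleared.
    obtain ⟨E, hE⟩ : ∃ E, E = d - a * b * c * (y * q ^ 2) * p := ⟨_, rfl⟩
    obtain ⟨F, hF⟩ : ∃ F, F = 1 - d * (x * q) * r := ⟨_, rfl⟩
    rw [← hE] at h1' ⊢
    rw [← hF] at h2 ⊢
    field_simp
    rw [hE, hF]
    ring
  linear_combination (q ^ 2 / (q - 1) ^ 2 * U * t * V * W) * key

/-- The double sum as a polynomial. -/
noncomputable def jacobiSumPoly (q a b c d : ℝ) (n m : ℕ) : MvPolynomial (Fin 2) ℝ :=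
  ∑ i ∈ Finset.range (n + 1), ∑ j ∈ Finset.range (m + 1),
    jacobiCoeff q a b c d n m i j • qPochBasis q (b / d) i j

lemma jacobiCoeff_eq_zero_left (hq : q ≠ 0) (n m j : ℕ) :
    jacobiCoeff q a b c d n m (n + 1) j = 0 := by
  rw [jacobiCoeff, hyperCoeff_eq_zero hq (Nat.lt_succ_self n), zero_mul, mul_zero]

lemma jacobiCoeff_eq_zero_right (hq : q ≠ 0) (n m i : ℕ) :
    jacobiCoeff q a b c d n m i (m + 1) = 0 := by
  rw [jacobiCoeff, hyperCoeff_eq_zero hq (Nat.lt_succ_self m), mul_zero, mul_zero]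

lemma isBigQJacobiImage_jacobiSumPoly (hq0 : 0 < q) (hq1 : q < 1) (ha0 : 0 < a * q)
    (ha1 : a * q < 1) (hb0 : 0 < b * q) (hb1 : b * q < 1) (hc0 : 0 < c * q) (hd : d < 0)
    (n m : ℕ) :
    IsBigQJacobiImage q a b c d (jacobiSumPoly q a b c d n m)
      (-bigQJacobiEigenvalue q a b c (n + m) • jacobiSumPoly q a b c d n m) := by
  have hb : b ≠ 0 := left_ne_zero_of_mul hb0.ne'
  have hq : q ≠ 0 := hq0.ne'
  have h := IsBigQJacobiImage.sum (Finset.range (n + 1)) fun i _ =>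
    IsBigQJacobiImage.sum (Finset.range (m + 1)) fun j _ =>
      (isBigQJacobiImage_qPochBasis hq0 hq1 a hb c hd.ne i j).smul (jacobiCoeff q a b c d n m i j)
  suffices e : ∑ i ∈ Finset.range (n + 1), ∑ j ∈ Finset.range (m + 1),
      jacobiCoeff q a b c d n m i j • (-bigQJacobiEigenvalue q a b c (i + j) •
        qPochBasis q (b / d) i j + basisImageLower q a b c d i j) =
      -bigQJacobiEigenvalue q a b c (n + m) • jacobiSumPoly q a b c d n m by
    rw [← e]
    exact h
  simp only [basisImageLower, smul_add, Finset.sum_add_distrib]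
  rw [Finset.sum_range_succ_shift (fun i => ∑ j ∈ Finset.range (m + 1),
      jacobiCoeff q a b c d n m i j • (q ^ 2 / (q - 1) ^ 2 * ((1 - q ^ i) * (1 - b * q ^ i) *
        (a * b * c * q / d - 1 / q ^ (i + j)))) • qPochBasis q (b / d) (i - 1) j) n
      (by simp) (by simp [jacobiCoeff_eq_zero_left hq]),
    Finset.sum_congr rfl fun i _ => Finset.sum_range_succ_shift (fun j =>
      jacobiCoeff q a b c d n m i j • (q ^ 2 / (q - 1) ^ 2 * ((1 - q ^ j) * (1 - a * q ^ j) *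
        (d - 1 / q ^ (i + j)))) • qPochBasis q (b / d) i (j - 1)) m
      (by simp) (by simp [jacobiCoeff_eq_zero_right hq]),
    Finset.sum_range_succ_shift (fun i => ∑ j ∈ Finset.range (m + 1),
      jacobiCoeff q a b c d n m i j • (q ^ 2 / (q - 1) ^ 2 * ((1 - q ^ i) * (1 - q ^ j) *
        (1 - b * q ^ i) * (1 - a * q ^ j) / q ^ (i + j))) •
        qPochBasis q (b / d) (i - 1) (j - 1)) n
      (by simp) (by simp [jacobiCoeff_eq_zero_left hq]),
    Finset.sum_congr rfl fun i _ => Finset.sum_range_succ_shift (fun j =>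
      jacobiCoeff q a b c d n m (i + 1) j • (q ^ 2 / (q - 1) ^ 2 * ((1 - q ^ (i + 1)) *
        (1 - q ^ j) * (1 - b * q ^ (i + 1)) * (1 - a * q ^ j) / q ^ (i + 1 + j))) •
        qPochBasis q (b / d) (i + 1 - 1) (j - 1)) m
      (by simp) (by simp [jacobiCoeff_eq_zero_right hq])]
  simp only [← Finset.sum_add_distrib, jacobiSumPoly, Finset.smul_sum, Nat.add_sub_cancel]
  -- After reindexing, all sums run over the same basis elements and the coefficients can be
  -- compared.
  refine Finset.sum_congr rfl fun i _ => Finset.sum_congr rfl fun j _ => ?_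
  simp only [smul_smul, ← add_smul]
  congr 1
  linear_combination jacobiCoeff_recurrence hq0 hq1 ha0 ha1 hb0 hb1 hc0 hd n m i j

/-- Reversing two of the products matches factors: `(1 - q^{j-n}) · q · (-t q^{n-1-j}) = t (1 -
q^{n-j})`. -/
lemma qPoch_inv_pow_mul_qPochLead {q : ℝ} (hq : q ≠ 0) (t : ℝ) (n : ℕ) :
    qPoch (q ^ (-(n : ℤ))) q n * q ^ n * qPochLead q t n = t ^ n * qPoch q q n := by
  have e : ∀ z : ℝ, z ^ n = ∏ _j ∈ Finset.range n, z := fun z => by simp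
  rw [qPochLead, qPoch, qPoch, e q, e t, ← Finset.prod_range_reflect (fun j => -(t * q ^ j)),
    ← Finset.prod_range_reflect (fun j => 1 - q * q ^ j), ← Finset.prod_mul_distrib,
    ← Finset.prod_mul_distrib, ← Finset.prod_mul_distrib]
  refine Finset.prod_congr rfl fun j hj => ?_
  have hj' : j + (n - 1 - j) + 1 = n := by
    have := Finset.mem_range.mp hj
    omega
  have hn : q ^ n = q ^ j * q ^ (n - 1 - j) * q := by rw [← pow_add, ← pow_succ, hj']
  have h1 : q ^ j ≠ 0 := pow_ne_zero _ hq
  have h2 : q ^ (n - 1 - j) ≠ 0 := pow_ne_zero _ hq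
  rw [zpow_neg, zpow_natCast, hn]
  generalize q ^ (n - 1 - j) = w at *
  field_simp
  ring

lemma hyperCoeff_self_mul_qPochLead (hq0 : 0 < q) (hq1 : q < 1) (t β ε : ℝ) (n : ℕ) :
    hyperCoeff q n β ε n * qPochLead q t n = t ^ n / (qPoch β q n * qPoch ε q n) := by
  have h := (qPoch_pos hq0 hq1 hq1 n).ne'
  rw [hyperCoeff, div_mul_eq_mul_div, qPoch_inv_pow_mul_qPochLead hq0.ne', mul_div_mul_right _ _ h]

lemma monicPrefactor_mul_lead (hq0 : 0 < q) (hq1 : q < 1) (ha0 : 0 < a * q) (ha1 : a * q < 1)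
    (hb0 : 0 < b * q) (hb1 : b * q < 1) (hc0 : 0 < c * q) (hc1 : c * q < 1) (hd : d < 0)
    (n m : ℕ) :
    monicPrefactor q a b c d n m *
      (jacobiCoeff q a b c d n m n m * (qPochLead q (b / d) n * qPochLead q 1 m)) = 1 := by
  have hb : b ≠ 0 := left_ne_zero_of_mul hb0.ne'
  have hd' : d ≠ 0 := hd.ne
  have hε : a * b * c * q ^ (m + 2) / d < 1 :=
    (mul_mul_pow_div_neg hq0 ha0 hb0 hc0 hd m).trans one_pos
  have hφ : d * q ^ (n + 1) < 1 := (mul_neg_of_neg_of_pos hd (by positivity)).trans one_pos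
  have h1 := (qPoch_pos hq0 hq1 hb1 n).ne'
  have h2 := (qPoch_pos hq0 hq1 hε n).ne'
  have h3 := (qPoch_pos hq0 hq1 ha1 m).ne'
  have h4 := (qPoch_pos hq0 hq1 hφ m).ne'
  have h5 : qPoch (a * b * c * q ^ (m + n + 2)) q (n + m) ≠ 0 := by
    -- For `n = m = 0` the bound on `abc q^2` is not available, but the product is empty.
    rcases Nat.eq_zero_or_pos (n + m) with h | h
    · rw [h, qPoch_zero]
      exact one_ne_zero
    · exact (qPoch_pos hq0 hq1
        (mul_pow_lt_one hq0 hq1 ha0 ha1 hb0 hb1 hc0 hc1 (by omega)) _).ne'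
  have e : jacobiCoeff q a b c d n m n m * (qPochLead q (b / d) n * qPochLead q 1 m) =
      qPoch (a * b * c * q ^ (m + n + 2)) q (n + m) *
        ((hyperCoeff q n (b * q) (a * b * c * q ^ (m + 2) / d) n * qPochLead q (b / d) n) *
        (hyperCoeff q m (a * q) (d * q ^ (n + 1)) m * qPochLead q 1 m)) := by
    rw [jacobiCoeff]
    ring
  rw [e, hyperCoeff_self_mul_qPochLead hq0 hq1, hyperCoeff_self_mul_qPochLead hq0 hq1,
    monicPrefactor, one_pow, div_pow, div_pow]
  generalize qPoch (b * q) q n = B₁ at *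
  generalize qPoch (a * b * c * q ^ (m + 2) / d) q n = B₂ at *
  generalize qPoch (a * q) q m = B₃ at *
  generalize qPoch (d * q ^ (n + 1)) q m = B₄ at *
  generalize qPoch (a * b * c * q ^ (m + n + 2)) q (n + m) = B₅ at *
  field_simp

lemma smul_jacobiSumPoly_sub_mem (hq0 : 0 < q) (hq1 : q < 1) (ha0 : 0 < a * q) (ha1 : a * q < 1)
    (hb0 : 0 < b * q) (hb1 : b * q < 1) (hc0 : 0 < c * q) (hc1 : c * q < 1) (hd : d < 0)
    (n m : ℕ) :
    monicPrefactor q a b c d n m • jacobiSumPoly q a b c d n m - X 0 ^ n * X 1 ^ m ∈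
      degLT (n + m) := by
  have hlead := monicPrefactor_mul_lead hq0 hq1 ha0 ha1 hb0 hb1 hc0 hc1 hd n m
  have h1 : jacobiSumPoly q a b c d n m - jacobiCoeff q a b c d n m n m • qPochBasis q (b / d) n m ∈
      degLT (n + m) := by
    rw [jacobiSumPoly, Finset.sum_range_succ, Finset.sum_range_succ _ m, ← add_assoc,
      add_sub_cancel_right]
    refine add_mem (Submodule.sum_mem _ fun i hi => Submodule.sum_mem _ fun j hj =>
      Submodule.smul_mem _ _ (qPochBasis_mem _ _ ?_)) (Submodule.sum_mem _ fun j hj =>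
      Submodule.smul_mem _ _ (qPochBasis_mem _ _ ?_))
    all_goals simp only [Finset.mem_range] at *; omega
  have h2 := Submodule.smul_mem _ (monicPrefactor q a b c d n m) (add_mem h1
    (Submodule.smul_mem _ (jacobiCoeff q a b c d n m n m) (qPochBasis_sub_mem q (b / d) n m)))
  convert h2 using 1
  rw [smul_sub (jacobiCoeff q a b c d n m n m), sub_add_sub_cancel, smul_sub, smul_smul, smul_smul,
    mul_assoc, hlead, one_smul]

lemma isMonicBigQJacobiSolution_smul_jacobiSumPoly (hq0 : 0 < q) (hq1 : q < 1) (ha0 : 0 < a * q)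
    (ha1 : a * q < 1) (hb0 : 0 < b * q) (hb1 : b * q < 1) (hc0 : 0 < c * q) (hc1 : c * q < 1)
    (hd : d < 0) (n m : ℕ) :
    IsMonicBigQJacobiSolution q a b c d n m
      (monicPrefactor q a b c d n m • jacobiSumPoly q a b c d n m) := by
  refine isMonicBigQJacobiSolution_iff.mpr
    ⟨smul_jacobiSumPoly_sub_mem hq0 hq1 ha0 ha1 hb0 hb1 hc0 hc1 hd n m, ?_⟩
  rw [smul_comm]
  exact (isBigQJacobiImage_jacobiSumPoly hq0 hq1 ha0 ha1 hb0 hb1 hc0 hd n m).smul _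

lemma IsMonicBigQJacobiSolution.unique (hq0 : 0 < q) (hq1 : q < 1) (ha0 : 0 < a * q)
    (ha1 : a * q < 1) (hb0 : 0 < b * q) (hb1 : b * q < 1) (hc0 : 0 < c * q) (hc1 : c * q < 1)
    (hd : d < 0) {n m : ℕ} {P P' : MvPolynomial (Fin 2) ℝ}
    (h : IsMonicBigQJacobiSolution q a b c d n m P)
    (h' : IsMonicBigQJacobiSolution q a b c d n m P') : P = P' := by
  rw [isMonicBigQJacobiSolution_iff] at h h'
  refine sub_eq_zero.mp (eq_zero_of_mem_degLT_of_image hq0 hq1 ha0 ha1 hb0 hb1 hc0 hc1 hd.ne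
    (N := n + m) ?_ le_rfl ?_)
  · rw [smul_sub]
    exact h.2.sub h'.2
  · simpa using sub_mem h.1 h'.1

end Solution

/-! ### The double sum and the Kampé de Fériet series -/

lemma two_dvd_exponent (i n : ℤ) : 2 ∣ i * (i - 2 * n + 1) := by
  have h : i * (i - 2 * n + 1) = i * (i + 1) - 2 * (n * i) := by ring
  rw [h]
  exact dvd_sub (Int.even_mul_succ_self i).two_dvd (dvd_mul_right _ _)

lemma exponent_succ (i n : ℤ) :
    (i + 1) * (i + 1 - 2 * n + 1) / 2 = i * (i - 2 * n + 1) / 2 + (i + 1 - n) := by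
  have h : (i + 1) * (i + 1 - 2 * n + 1) = i * (i - 2 * n + 1) + (i + 1 - n) * 2 := by ring
  rw [h, Int.add_mul_ediv_right _ _ two_ne_zero]

/-- This links the two displayed forms. In the induction on `i`, the new factor `1 - q^{i-n}`
supplies the sign, the `q`-binomial ratio and the power `q^{i+1-n}`. -/
lemma qPoch_inv_pow_div {q : ℝ} (hq0 : 0 < q) (hq1 : q < 1) {n i : ℕ} (h : i ≤ n) :
    qPoch (q ^ (-(n : ℤ))) q i * q ^ i / qPoch q q i =
      (-1) ^ i * qBinom q n i * q ^ ((i : ℤ) * ((i : ℤ) - 2 * (n : ℤ) + 1) / 2) := by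
  have hq : q ≠ 0 := hq0.ne'
  induction i with
  | zero =>
    have := (qPoch_pos hq0 hq1 hq1 n).ne'
    simp [qPoch_zero, qBinom, this]
  | succ i ih =>
    have ih := ih (by omega)
    have h1 := (qPoch_pos hq0 hq1 hq1 i).ne'
    have h2 := (one_sub_mul_pow_pos hq0 hq1 hq1 i).ne'
    -- Writing `n = i + 1 + l` removes the natural-number subtraction from the `q`-binomials.
    obtain ⟨l, rfl⟩ := Nat.exists_eq_add_of_le h
    have h3 := (qPoch_pos hq0 hq1 hq1 l).ne'
    have h4 := (one_sub_mul_pow_pos hq0 hq1 hq1 l).ne'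
    have e1 : i + 1 + l - i = l + 1 := by omega
    have e2 : i + 1 + l - (i + 1) = l := by omega
    have e3 : (i : ℤ) + 1 - ((i + 1 + l : ℕ) : ℤ) = -(l : ℤ) := by push_cast; ring
    rw [qBinom, e1] at ih
    rw [qBinom, e2, Nat.cast_succ, exponent_succ, zpow_add₀ hq, e3]
    have s1 : qPoch (q ^ (-((i + 1 + l : ℕ) : ℤ))) q (i + 1) * q ^ (i + 1) / qPoch q q (i + 1) =
        qPoch (q ^ (-((i + 1 + l : ℕ) : ℤ))) q i * q ^ i / qPoch q q i *
          ((1 - q ^ (-((i + 1 + l : ℕ) : ℤ)) * q ^ i) * q / (1 - q * q ^ i)) := by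
      rw [qPoch_succ, qPoch_succ, pow_succ]
      field_simp
    rw [s1, ih, qPoch_succ q q l, qPoch_succ q q i]
    have hi : q ^ i ≠ 0 := pow_ne_zero _ hq
    have hl : q ^ l ≠ 0 := pow_ne_zero _ hq
    have e4 : q ^ (-((i + 1 + l : ℕ) : ℤ)) = (q ^ i * q * q ^ l)⁻¹ := by
      rw [zpow_neg, zpow_natCast, pow_add, pow_succ]
    rw [e4, zpow_neg q (l : ℤ), zpow_natCast]
    field_simp
    ring

section Kampe

variable {q : ℝ} (a b c d : ℝ)

lemma monicKampeTerm_eq (q : ℝ) (n m : ℕ) (x y : ℝ) (i j : ℕ) :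
    monicKampeTerm q a b c d n m x y (i, j) =
      jacobiCoeff q a b c d n m i j * (qPoch (b / d * x) q i * qPoch (1 * y) q j) := by
  have e : b * x / d = b / d * x := by ring
  simp only [monicKampeTerm, qKampeTerm, qPochList, jacobiCoeff, hyperCoeff, List.map_cons,
    List.map_nil, List.prod_cons, List.prod_nil, mul_one, one_mul, zero_mul, add_zero, zpow_zero, e,
    add_comm n m]
  ring

lemma monicKampeTerm_eq_zero (hq : q ≠ 0) {n m i j : ℕ} (h : n < i ∨ m < j) (x y : ℝ) :
    monicKampeTerm q a b c d n m x y (i, j) = 0 := by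
  rw [monicKampeTerm_eq, jacobiCoeff]
  rcases h with h | h <;> simp [hyperCoeff_eq_zero hq h]

lemma evalXY_jacobiSumPoly (q : ℝ) (n m : ℕ) (x y : ℝ) :
    evalXY (jacobiSumPoly q a b c d n m) x y =
      ∑ p ∈ Finset.range (n + 1) ×ˢ Finset.range (m + 1), monicKampeTerm q a b c d n m x y p := by
  simp only [jacobiSumPoly, evalXY_sum, evalXY_smul, evalXY_qPochBasis, Finset.sum_product,
    monicKampeTerm_eq]

lemma hasSum_monicKampeTerm (hq : q ≠ 0) (n m : ℕ) (x y : ℝ) :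
    HasSum (monicKampeTerm q a b c d n m x y) (evalXY (jacobiSumPoly q a b c d n m) x y) := by
  rw [evalXY_jacobiSumPoly]
  refine hasSum_sum_of_ne_finset_zero fun p hp => monicKampeTerm_eq_zero a b c d hq ?_ x y
  simp only [Finset.mem_product, Finset.mem_range] at hp
  omega

lemma monicDoubleSum_eq (hq0 : 0 < q) (hq1 : q < 1) (n m : ℕ) (x y : ℝ) :
    monicDoubleSum q a b c d n m x y = evalXY (jacobiSumPoly q a b c d n m) x y := by
  rw [evalXY_jacobiSumPoly, Finset.sum_product, monicDoubleSum]
  refine Finset.sum_congr rfl fun i hi => Finset.sum_congr rfl fun j hj => ?_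
  have hV := qPoch_inv_pow_div hq0 hq1 (Nat.lt_succ_iff.mp (Finset.mem_range.mp hi))
  have hW := qPoch_inv_pow_div hq0 hq1 (Nat.lt_succ_iff.mp (Finset.mem_range.mp hj))
  have hs : (-1 : ℝ) ^ (-(i : ℤ) - (j : ℤ)) = (-1) ^ i * (-1) ^ j := by
    rw [zpow_sub₀ (by norm_num), zpow_neg, zpow_natCast, zpow_natCast, ← inv_pow, div_eq_mul_inv,
      ← inv_pow]
    norm_num
  have e : b * x / d = b / d * x := by ring
  rw [monicKampeTerm_eq, Int.add_ediv_of_dvd_left (two_dvd_exponent _ _), zpow_add₀ hq0.ne', hs, e,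
    one_mul]
  have split : ∀ (k l : ℕ) (β ε : ℝ), hyperCoeff q l β ε k =
      qPoch (q ^ (-(l : ℤ))) q k * q ^ k / qPoch q q k / (qPoch β q k * qPoch ε q k) := by
    intro k l β ε
    rw [hyperCoeff, div_div, mul_comm (qPoch q q k)]
  rw [jacobiCoeff, split, split, hV, hW]
  ring

end Kampe

end Polynomials

theorem mainTheorem9 (q a b c d : ℝ) (hq0 : 0 < q) (hq1 : q < 1)
    (ha0 : 0 < a * q) (ha1 : a * q < 1) (hb0 : 0 < b * q) (hb1 : b * q < 1)
    (hc0 : 0 < c * q) (hc1 : c * q < 1) (hd : d < 0) (n m : ℕ) :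
    (∃! P : MvPolynomial (Fin 2) ℝ, IsMonicBigQJacobiSolution q a b c d n m P) ∧
    ∀ P : MvPolynomial (Fin 2) ℝ, IsMonicBigQJacobiSolution q a b c d n m P →
      ∀ x y : ℝ,
        evalXY P x y = monicPrefactor q a b c d n m * monicDoubleSum q a b c d n m x y ∧
        (∀ i j : ℕ, n < i ∨ m < j → monicKampeTerm q a b c d n m x y (i, j) = 0) ∧
        Summable (monicKampeTerm q a b c d n m x y) ∧
        evalXY P x y = monicPrefactor q a b c d n m * monicKampe q a b c d n m x y := by
  have hsol := isMonicBigQJacobiSolution_smul_jacobiSumPoly hq0 hq1 ha0 ha1 hb0 hb1 hc0 hc1 hd n m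
  refine ⟨⟨_, hsol, fun P hP => hP.unique hq0 hq1 ha0 ha1 hb0 hb1 hc0 hc1 hd hsol⟩,
    fun P hP x y => ?_⟩
  have hsum := hasSum_monicKampeTerm a b c d hq0.ne' n m x y
  have hP' : evalXY P x y =
      monicPrefactor q a b c d n m * evalXY (jacobiSumPoly q a b c d n m) x y := by
    rw [hP.unique hq0 hq1 ha0 ha1 hb0 hb1 hc0 hc1 hd hsol, evalXY_smul]
  refine ⟨?_, fun i j h => monicKampeTerm_eq_zero a b c d hq0.ne' h x y, hsum.summable, ?_⟩
  · rw [hP', monicDoubleSum_eq a b c d hq0 hq1]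
  · rw [hP', ← hsum.tsum_eq]
    rfl
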